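/- All graphs are finite, undirected and simple. For a graph $G$ and a set $S\subseteq V(G)$ with $|S|\ge 2$, an $S$-tree is a subgraph of $G$ that is a tree and whose vertex set contains $S$. Two $S$-trees $T_1,T_2$ are internally disjoint if $E(T_1)\cap E(T_2)=\varnothing$ and $V(T_1)\cap V(T_2)=S$. Let $\kappa(S)$ be the maximum number of pairwise internally disjoint $S$-trees in $G$. For an integer $k\ge 2$ put $\kappa_k(G)=\min\{\kappa(S): S\subseteq V(G),\ |S|=k\}$ if $G$ is connected with at least $k$ vertices, $\kappa_k(G)=1$ if $G$ is connected with fewer than $k$ vertices, and $\kappa_k(G)=0$ if $G$ is disconnected. The lexicographic product $G\circ H$ has vertex set $V(G)\times V(H)$, and $(u,v)$, $(u',v')$ are adjacent if and only if either $uu'\in E(G)$, or $u=u'$ and $vv'\in E(H)$. **Proposition 2.7.** Let $T$ be a tree with at least two vertices and let $H$ be a connected graph. Then $\kappa_3(T\circ H)\ge |V(H)|$. Moreover, the bound is sharp: for every $n\ge 4$, the star $K_{1,n-1}$ and the path $P_3$ on three vertices satisfy $\kappa_3(K_{1,n-1}\circ P_3)=3=|V(P_3)|$. -/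

import Mathlib

namespace GenConn

universe u v

/-- The lexicographic product `G ∘ H`: `(u, v)` and `(u', v')` are adjacent iff
`u u'` is an edge of `G`, or `u = u'` and `v v'` is an edge of `H`. -/
def lexProduct {V : Type u} {W : Type v} (G : SimpleGraph V) (H : SimpleGraph W) :
    SimpleGraph (V × W) where
  Adj p q := G.Adj p.1 q.1 ∨ (p.1 = q.1 ∧ H.Adj p.2 q.2)
  symm := ⟨fun _ _ h => h.imp (fun h => h.symm) (fun h => ⟨h.1.symm, h.2.symm⟩)⟩
  loopless := ⟨fun _ h => h.elim (fun h => G.irrefl h) (fun h => H.irrefl h.2)⟩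

/-- `T` is an `S`-Steiner tree of `G`: a subgraph that is a tree and contains `S`. -/
def IsSteinerTree {V : Type u} {G : SimpleGraph V} (S : Set V) (T : G.Subgraph) : Prop :=
  T.coe.IsTree ∧ S ⊆ T.verts

/-- Two `S`-trees are internally disjoint: no common edge, and the common vertices are
exactly those of `S`. -/
def InternallyDisjoint {V : Type u} {G : SimpleGraph V} (S : Set V) (T T' : G.Subgraph) : Prop :=
  T.edgeSet ∩ T'.edgeSet = ∅ ∧ T.verts ∩ T'.verts = S

/-- `F` is a set of pairwise internally disjoint `S`-trees of `G`. -/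
def IsDisjointTreeFamily {V : Type u} {G : SimpleGraph V} (S : Set V) (F : Set G.Subgraph) :
    Prop :=
  (∀ T ∈ F, IsSteinerTree S T) ∧ F.Pairwise (InternallyDisjoint S)

/-- The generalized local connectivity `κ(S)`: the maximum number of pairwise internally
disjoint `S`-trees in `G`. It is meant for `2 ≤ |S|`. -/
noncomputable def localConn {V : Type u} (G : SimpleGraph V) (S : Set V) : ℕ∞ :=
  ⨆ (F : Set G.Subgraph) (_ : IsDisjointTreeFamily S F), F.encard

open Classical in
/-- The generalized `k`-connectivity `κ_k(G)` (for `2 ≤ k`): the minimum of `κ(S)` over the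
`k`-element vertex sets `S`; by convention it is `0` for a graph that is not connected and `1`
for a connected graph with fewer than `k` vertices. -/
noncomputable def genConn {V : Type u} (k : ℕ) (G : SimpleGraph V) : ℕ∞ :=
  if ¬ G.Connected then 0
  else if ENat.card V < k then 1
  else ⨅ (S : Set V) (_ : S.encard = k), localConn G S

end GenConn

/-! Lower bound: for three vertices `S` of `T ∘ H`, one `S`-tree is built per `w : W`. If a
connected set `I` of `T` is adjacent to each fibre met by `S` and avoids these fibres, the disjoint
copies `I × {w}` suffice. Such an `I` is sought as a minimal connected set dominating the projection
of `S`. Unless it is a singleton, it misses two projected points (`exists_connected_dominating`), so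
at most one vertex of `S` lies in a copy. That copy is harmless: a single tree may use edges inside
`S` (`card_le_localConn`). The remaining configurations, with `S` on adjacent fibres, get explicit
trees of one or two extra vertices, matched by a permutation of `W`. Sharpness: for `S` in three
leaf fibres of a star, every `S`-tree crosses the central fibre, and distinct trees do so in
distinct vertices. -/

namespace GenConn

open SimpleGraph

/-! ### Connected dominating sets and packings of `S`-trees in general graphs -/

section General

variable {V : Type*} {G : SimpleGraph V}

/-- Adding to a connected vertex set vertices that are adjacent to it keeps it connected. -/
lemma connected_induce_union_of_adj {C S : Set V} (hC : (G.induce C).Connected)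
    (hS : ∀ s ∈ S, s ∈ C ∨ ∃ c ∈ C, G.Adj s c) : (G.induce (S ∪ C)).Connected := by
  obtain ⟨⟨u, hu⟩⟩ := hC.nonempty
  refine G.induce_connected_of_patches u (Or.inr hu) fun {v} hv => ?_
  by_cases hvC : v ∈ C
  · exact ⟨C, Set.subset_union_right, hu, hvC, hC.preconnected _ _⟩
  · obtain ⟨c, hc, hadj⟩ := (hS v (hv.resolve_right hvC)).resolve_left hvC
    refine ⟨{v} ∪ C, Set.union_subset (Set.singleton_subset_iff.2 hv) Set.subset_union_right,
      Or.inr hu, Or.inl rfl, ?_⟩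
    exact (connected_induce_union (Preconnected.of_subsingleton) hC.preconnected
      (Set.mem_singleton v) hc hadj).preconnected _ _

lemma connected_induce_singleton (v : V) : (G.induce {v}).Connected :=
  .of_subsingleton

/-- A connected subset with at least two elements has two distinct elements either of which can
be deleted without destroying connectedness. -/
lemma exists_ne_connected_induce_diff [Finite V] {I : Set V} (hI : (G.induce I).Connected)
    (hn : I.Nontrivial) : ∃ u ∈ I, ∃ v ∈ I, u ≠ v ∧ (G.induce (I \ {u})).Connected ∧
      (G.induce (I \ {v})).Connected := by
  classical
  obtain ⟨T, hle, hT⟩ := hI.exists_isTree_le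
  have : Nontrivial I := hn.coe_sort
  have := Fintype.ofFinite I
  obtain ⟨u, v, huv, hu, hv⟩ := hT.exists_ne_and_degree_eq_one
  have key : ∀ w : I, T.degree w = 1 → (G.induce (I \ {w.1})).Connected := by
    intro w hw
    have h := (hT.connected.induce_compl_singleton_of_degree_eq_one hw)
    let f : T.induce {w}ᶜ →g G.induce (I \ {w.1}) :=
      { toFun := fun x => ⟨x.1.1, x.1.2, fun h => x.2 (Subtype.ext h)⟩
        map_rel' := fun {a b} hab => by
          have : T.Adj a.1 b.1 := hab
          exact hle this }
    refine h.map f ?_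
    rintro ⟨x, hx, hxw⟩
    exact ⟨⟨⟨x, hx⟩, fun h => hxw (congrArg Subtype.val h)⟩, rfl⟩
  exact ⟨u, u.2, v, v.2, fun h => huv (Subtype.ext h), key u hu, key v hv⟩

lemma exists_adj_mem_of_connected_induce {I : Set V} (hI : (G.induce I).Connected)
    (hn : I.Nontrivial) {u : V} (hu : u ∈ I) : ∃ q ∈ I, G.Adj u q := by
  have : Nontrivial I := hn.coe_sort
  obtain ⟨q, hq⟩ := hI.preconnected.exists_adj_of_nontrivial ⟨u, hu⟩
  exact ⟨q, q.2, hq⟩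

/-- In a finite connected graph every set `U` of vertices is dominated by a connected set that is
a singleton or misses at least two elements of `U`. -/
lemma exists_connected_dominating [Finite V] (hG : G.Connected) (U : Set V) :
    ∃ I : Set V, (G.induce I).Connected ∧ (∀ u ∈ U, u ∈ I ∨ ∃ q ∈ I, G.Adj u q) ∧
      (I.Subsingleton ∨ (U \ I).Nontrivial) := by
  classical
  let P : Set V → Prop := fun I => (G.induce I).Connected ∧ ∀ u ∈ U, u ∈ I ∨ ∃ q ∈ I, G.Adj u q
  have huniv : P Set.univ :=
    ⟨(induceUnivIso G).connected_iff.2 hG, fun u _ => Or.inl (Set.mem_univ u)⟩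
  obtain ⟨I, -, hmin⟩ := (Set.toFinite {I | P I}).exists_le_minimal huniv
  have hI : P I := hmin.prop
  refine ⟨I, hI.1, hI.2, ?_⟩
  rw [or_iff_not_imp_left, Set.not_subsingleton_iff]
  intro hn
  obtain ⟨u, hu, v, hv, huv, hcu, hcv⟩ := exists_ne_connected_induce_diff hI.1 hn
  -- By minimality, deleting `w` breaks domination. What is lost lies in `U \ I` and has `w` as its
  -- only neighbour in `I`; two deletable vertices thus give two distinct such points.
  have key : ∀ w ∈ I, (G.induce (I \ {w})).Connected →
      ∃ x ∈ U \ I, ∀ q ∈ I, G.Adj x q → q = w := by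
    intro w hw hc
    by_contra! hcon
    have hP : P (I \ {w}) := by
      refine ⟨hc, fun x hx => ?_⟩
      by_cases hxI : x ∈ I
      · by_cases hxw : x = w
        · obtain ⟨q, hq, hadj⟩ := exists_adj_mem_of_connected_induce hI.1 hn hxI
          exact Or.inr ⟨q, ⟨hq, fun h => hadj.ne (hxw.trans (Eq.symm h))⟩, hadj⟩
        · exact Or.inl ⟨hxI, hxw⟩
      · obtain ⟨q, hq, hadj, hqw⟩ := hcon x ⟨hx, hxI⟩
        exact Or.inr ⟨q, ⟨hq, hqw⟩, hadj⟩
    exact (hmin.le_of_le hP Set.sdiff_subset hw).2 rfl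
  obtain ⟨x, hx, hxu⟩ := key u hu hcu
  obtain ⟨y, hy, hyv⟩ := key v hv hcv
  refine ⟨x, hx, y, hy, ?_⟩
  rintro rfl
  obtain ⟨q, hq, hadj⟩ := (hI.2 x hx.1).resolve_left hx.2
  exact huv ((hxu q hq hadj).symm.trans (hyv q hq hadj))

/-- Connected vertex sets containing `S` that meet pairwise in `S` only, in subgraphs of `G` that
share no edge inside `S`, yield internally disjoint `S`-trees. -/
lemma card_le_localConn_of_connected {ι : Type*} [Fintype ι] {S : Set V} (hS : S.Nontrivial)
    (H : ι → SimpleGraph V) (X : ι → Set V) (hH : ∀ i, H i ≤ G)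
    (hconn : ∀ i, ((H i).induce (X i)).Connected) (hSX : ∀ i, S ⊆ X i)
    (hX : ∀ i j, i ≠ j → X i ∩ X j ⊆ S)
    (hdisj : ∀ i j, i ≠ j → ∀ u ∈ S, ∀ v ∈ S, (H i).Adj u v → ¬ (H j).Adj u v) :
    (Fintype.card ι : ℕ∞) ≤ localConn G S := by
  choose T hle hT using fun i => (hconn i).exists_isTree_le
  let K : ι → G.Subgraph := fun i =>
    { verts := X i
      Adj := fun u v => ∃ (hu : u ∈ X i) (hv : v ∈ X i), (T i).Adj ⟨u, hu⟩ ⟨v, hv⟩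
      adj_sub := fun h => hH i (hle i h.2.2)
      edge_vert := fun h => h.1
      symm := ⟨fun _ _ h => ⟨h.2.1, h.1, h.2.2.symm⟩⟩ }
  have hK : ∀ i, (K i).coe = T i := fun i => by
    ext u v
    exact ⟨fun h => h.2.2, fun h => ⟨u.2, v.2, h⟩⟩
  have hedge : ∀ i j, i ≠ j → (K i).edgeSet ∩ (K j).edgeSet = ∅ := by
    intro i j hij
    refine Set.eq_empty_of_forall_notMem (Sym2.ind fun u v => ?_)
    rintro ⟨h, h'⟩
    rw [Subgraph.mem_edgeSet] at h h'
    obtain ⟨hu, hv, h⟩ := h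
    obtain ⟨hu', hv', h'⟩ := h'
    exact hdisj i j hij u (hX i j hij ⟨hu, hu'⟩) v (hX i j hij ⟨hv, hv'⟩) (hle i h) (hle j h')
  -- Trees with an edge and disjoint edge sets are distinct, so the family has as many members as
  -- `ι`.
  have hne : ∀ i, (K i).edgeSet.Nonempty := by
    intro i
    have : Nontrivial (X i) := (hS.mono (hSX i)).coe_sort
    obtain ⟨⟨a, ha⟩⟩ := (hconn i).nonempty
    obtain ⟨b, hb⟩ := (hT i).connected.preconnected.exists_adj_of_nontrivial ⟨a, ha⟩
    exact ⟨s(a, b), ha, b.2, hb⟩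
  have hinj : Function.Injective K := by
    intro i j h
    by_contra hij
    have := hedge i j hij
    rw [h, Set.inter_self] at this
    exact (hne j).ne_empty this
  have hF : IsDisjointTreeFamily S (Set.range K) := by
    refine ⟨?_, ?_⟩
    · rintro _ ⟨i, rfl⟩
      exact ⟨by rw [hK]; exact hT i, hSX i⟩
    · rintro _ ⟨i, rfl⟩ _ ⟨j, rfl⟩ hij
      have hij' : i ≠ j := fun h => hij (congrArg K h)
      exact ⟨hedge i j hij', (hX i j hij').antisymm (Set.subset_inter (hSX i) (hSX j))⟩
  have hcard : (Set.range K).encard = Fintype.card ι := by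
    rw [← Set.image_univ, hinj.encard_image, Set.encard_univ, ENat.card_eq_coe_fintype_card]
  rw [← hcard]
  exact le_iSup₂_of_le (Set.range K) hF le_rfl

/-- Disjoint connected sets `A i` outside `S`, each adjacent to every vertex of `S`, yield
internally disjoint `S`-trees. One exceptional set `A i` need only be connected together
with `S`. -/
lemma card_le_localConn {ι : Type*} [Fintype ι] {S : Set V} (hS : S.Nontrivial)
    (A : ι → Set V) (e : Option ι) (hA : ∀ i j v, v ∈ A i → v ∈ A j → i = j)
    (he : ∀ i ∈ e, (G.induce (S ∪ A i)).Connected)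
    (hdisj : ∀ i ∉ e, ∀ v ∈ A i, v ∉ S) (hconn : ∀ i ∉ e, (G.induce (A i)).Connected)
    (hadj : ∀ i ∉ e, ∀ s ∈ S, ∃ q ∈ A i, G.Adj s q) :
    (Fintype.card ι : ℕ∞) ≤ localConn G S := by
  classical
  -- Only the exceptional tree keeps the edges inside `S`, so no two trees share one.
  refine card_le_localConn_of_connected hS (fun i => if i ∈ e then G else G.deleteEdges S.sym2)
    (fun i => S ∪ A i) (fun i => ?_) (fun i => ?_) (fun i => Set.subset_union_left)
    (fun i j hij => ?_) (fun i j hij u hu v hv h h' => ?_)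
  · split_ifs
    exacts [le_rfl, deleteEdges_le _]
  · split_ifs with hi
    · exact he i hi
    · refine connected_induce_union_of_adj ((hconn i hi).mono fun u v huv => ?_) fun s hs => ?_
      · have huv' : G.Adj u v := huv
        change (G.deleteEdges S.sym2).Adj u v
        rw [deleteEdges_adj]
        exact ⟨huv', fun h => hdisj i hi u u.2 (Set.mk_mem_sym2_iff.1 h).1⟩
      · obtain ⟨q, hq, h⟩ := hadj i hi s hs
        refine Or.inr ⟨q, hq, ?_⟩
        rw [deleteEdges_adj]
        exact ⟨h, fun h => hdisj i hi q hq (Set.mk_mem_sym2_iff.1 h).2⟩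
  · rintro v ⟨h | h, h' | h'⟩
    exacts [h, h, h', absurd (hA i j v h h') hij]
  · have key : ∀ k, (if k ∈ e then G else G.deleteEdges S.sym2).Adj u v → k ∈ e := by
      intro k hk
      by_contra hke
      rw [if_neg hke, deleteEdges_adj] at hk
      exact hk.2 (Set.mk_mem_sym2_iff.2 ⟨hu, hv⟩)
    exact hij (Option.mem_unique (key i h) (key j h'))

end General

/-! ### Lower bound for lexicographic products -/

section LexProduct

variable {V W : Type*} {T : SimpleGraph V} {H : SimpleGraph W}

lemma lexProduct_adj {p q : V × W} :
    (lexProduct T H).Adj p q ↔ T.Adj p.1 q.1 ∨ (p.1 = q.1 ∧ H.Adj p.2 q.2) := Iff.rfl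

lemma connected_induce_lexProduct_prod_singleton {I : Set V} (hI : (T.induce I).Connected) (w : W) :
    ((lexProduct T H).induce (I ×ˢ {w})).Connected := by
  let f : T.induce I →g (lexProduct T H).induce (I ×ˢ {w}) :=
    { toFun := fun v => ⟨(v.1, w), v.2, rfl⟩
      map_rel' := fun {a b} hab => Or.inl hab }
  refine hI.map f ?_
  rintro ⟨⟨v, w'⟩, hv, hw⟩
  obtain rfl : w' = w := hw
  exact ⟨⟨v, hv⟩, rfl⟩

lemma connected_lexProduct [Nontrivial V] [Nonempty W] (hT : T.Connected) :
    (lexProduct T H).Connected := by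
  obtain ⟨w⟩ := ‹Nonempty W›
  have h := connected_induce_union_of_adj (S := Set.univ)
    (connected_induce_lexProduct_prod_singleton (H := H)
      ((induceUnivIso T).connected_iff.2 hT) w) (fun s _ => by
        obtain ⟨q, hq⟩ := hT.preconnected.exists_adj_of_nontrivial s.1
        exact Or.inr ⟨(q, w), ⟨trivial, rfl⟩, Or.inl hq⟩)
  rw [Set.univ_union] at h
  exact (induceUnivIso _).connected_iff.1 h

/-- A connected set `I` of `T` adjacent to all fibres met by `S` yields the `S`-trees through
`I × {w}`, provided that `S` meets `I × W` in at most one copy `I × {w}`. -/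
lemma card_le_localConn_lexProduct_of_adj [Fintype W] {S : Set (V × W)} (hS : S.Nontrivial)
    {I : Set V} (hI : (T.induce I).Connected) (hadj : ∀ s ∈ S, ∃ q ∈ I, T.Adj s.1 q)
    (e : Option W) (he : ∀ s ∈ S, s.1 ∈ I → s.2 ∈ e) :
    (Fintype.card W : ℕ∞) ≤ localConn (lexProduct T H) S := by
  have hadj' : ∀ w, ∀ s ∈ S, ∃ q ∈ I ×ˢ {w}, (lexProduct T H).Adj s q := fun w s hs => by
    obtain ⟨q, hq, h⟩ := hadj s hs
    exact ⟨(q, w), ⟨hq, rfl⟩, Or.inl h⟩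
  refine card_le_localConn hS (fun w => I ×ˢ {w}) e ?_ (fun w _ => ?_) (fun w hw v hv hvS => ?_)
    (fun w _ => connected_induce_lexProduct_prod_singleton hI w) (fun w _ => hadj' w)
  · rintro i j v ⟨-, rfl⟩ ⟨-, h⟩
    exact h
  · exact connected_induce_union_of_adj (connected_induce_lexProduct_prod_singleton hI w)
      fun s hs => Or.inr (hadj' w s hs)
  · obtain rfl : v.2 = w := hv.2
    exact hw (he v hvS hv.1)

lemma nontrivial_triple {α : Type*} {x y : α} (z : α) (h : x ≠ y) :
    ({x, y, z} : Set α).Nontrivial :=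
  ⟨x, by simp, y, by simp, h⟩

lemma card_le_localConn_lexProduct_of_adj_adj [Fintype W] {x y z : V × W}
    (hxy : T.Adj x.1 y.1) (hyz : T.Adj y.1 z.1) (hxz : x.1 ≠ z.1) :
    (Fintype.card W : ℕ∞) ≤ localConn (lexProduct T H) {x, y, z} := by
  classical
  obtain ⟨u, a⟩ := x
  obtain ⟨v, b⟩ := y
  obtain ⟨t, c⟩ := z
  dsimp only at hxy hyz hxz
  refine card_le_localConn (nontrivial_triple _ fun h => hxy.ne (congrArg Prod.fst h))
    -- `(v, w)` reaches `x` and `z`, while the vertex over `u` reaches `y`. The swap puts `x` and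
    -- `y` into the same set, of index `b`, so only one set meets `S`.
    (fun w => {(v, w), (u, Equiv.swap a b w)}) (some b) ?_ (fun w hw => ?_) (fun w hw => ?_)
    (fun w hw => ?_) (fun w hw => ?_)
  · rintro i j p (rfl | rfl) (h | h)
    · simpa using h
    · exact absurd (congrArg Prod.fst h) hxy.ne'
    · exact absurd (congrArg Prod.fst h) hxy.ne
    · simpa using h
  · obtain rfl : b = w := by simpa using hw
    have : ({(u, a), (v, b), (t, c)} ∪ {(v, b), (u, Equiv.swap a b b)} : Set (V × W)) =
        {(u, a), (v, b), (t, c)} ∪ {(v, b)} := by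
      rw [Equiv.swap_apply_right]
      ext p
      simp
    rw [this]
    refine connected_induce_union_of_adj (connected_induce_singleton _) ?_
    rintro s (rfl | rfl | rfl)
    · exact Or.inr ⟨_, rfl, Or.inl hxy⟩
    · exact Or.inl rfl
    · exact Or.inr ⟨_, rfl, Or.inl hyz.symm⟩
  · have hwb : w ≠ b := fun h => hw (by simp [h])
    have hwa : Equiv.swap a b w ≠ a := fun h => hwb (by
      rw [Equiv.swap_apply_eq_iff, Equiv.swap_apply_left] at h; exact h)
    rintro p (rfl | rfl)
    · simp [hwb, hxy.ne', hyz.ne]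
    · simp [hwa, hxy.ne, hxz]
  · exact induce_pair_connected_of_adj (Or.inl hxy.symm)
  · rintro s (rfl | rfl | rfl)
    · exact ⟨(v, w), by simp, Or.inl hxy⟩
    · exact ⟨(u, Equiv.swap a b w), by simp, Or.inl hxy.symm⟩
    · exact ⟨(v, w), by simp, Or.inl hyz.symm⟩

lemma exists_perm_apply_eq_apply_eq {α : Type*} [DecidableEq α] {a b c d : α} (hab : a ≠ b)
    (hcd : c ≠ d) : ∃ σ : Equiv.Perm α, σ c = a ∧ σ d = b := by
  have h : a ≠ Equiv.swap c a d := fun h => hcd (by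
    rw [eq_comm, Equiv.swap_apply_eq_iff, Equiv.swap_apply_right] at h; exact h.symm)
  refine ⟨Equiv.swap (Equiv.swap c a d) b * Equiv.swap c a, ?_, ?_⟩
  · rw [Equiv.Perm.mul_apply, Equiv.swap_apply_left, Equiv.swap_apply_of_ne_of_ne h hab]
  · rw [Equiv.Perm.mul_apply, Equiv.swap_apply_left]

/-- Two vertices over `u` must be kept out of all but one set. With `σ c = a`, the set of index `c`
absorbs `(u, a)` and `(v, c)`. The index `d` with `σ d = b` is an `H`-neighbour of `c`, so `(v, d)`
reaches `(v, c)` directly and `(u, b)` is not needed there. -/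
lemma card_le_localConn_lexProduct_of_fst_eq_of_adj [Fintype W] (hH : H.Connected) {u v : V}
    {a b c : W} (hab : a ≠ b) (huv : T.Adj u v) :
    (Fintype.card W : ℕ∞) ≤ localConn (lexProduct T H) {(u, a), (u, b), (v, c)} := by
  classical
  have : Nontrivial W := ⟨a, b, hab⟩
  obtain ⟨d, hcd⟩ := hH.preconnected.exists_adj_of_nontrivial c
  obtain ⟨σ, hσc, hσd⟩ := exists_perm_apply_eq_apply_eq hab hcd.ne
  refine card_le_localConn (nontrivial_triple _ (by simpa using hab))
    (fun w => {p | p = (v, w) ∨ w ≠ d ∧ p = (u, σ w)}) (some c) ?_ (fun w hw => ?_)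
    (fun w hw => ?_) (fun w hw => ?_) (fun w hw => ?_)
  · rintro i j p (rfl | ⟨-, rfl⟩) (h | ⟨-, h⟩)
    · simpa using h
    · exact absurd (congrArg Prod.fst h) huv.ne'
    · exact absurd (congrArg Prod.fst h) huv.ne
    · simpa using h
  · obtain rfl : c = w := by simpa using hw
    have : ({(u, a), (u, b), (v, c)} ∪ {p | p = (v, c) ∨ c ≠ d ∧ p = (u, σ c)} : Set (V × W)) =
        {(u, a), (u, b), (v, c)} ∪ {(v, c)} := by
      ext p
      rw [hσc]
      simp
      tauto
    rw [this]
    refine connected_induce_union_of_adj (connected_induce_singleton _) ?_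
    rintro s (rfl | rfl | rfl)
    · exact Or.inr ⟨_, rfl, Or.inl huv⟩
    · exact Or.inr ⟨_, rfl, Or.inl huv⟩
    · exact Or.inl rfl
  · have hwc : w ≠ c := fun h => hw (by simp [h])
    rintro p (rfl | ⟨hwd, rfl⟩)
    · simp [hwc, huv.ne']
    · have h1 : σ w ≠ a := fun h => hwc (σ.injective (h.trans hσc.symm))
      have h2 : σ w ≠ b := fun h => hwd (σ.injective (h.trans hσd.symm))
      simp [h1, h2, huv.ne]
  · by_cases hwd : w = d
    · have : ({p | p = (v, w) ∨ w ≠ d ∧ p = (u, σ w)} : Set (V × W)) = {(v, w)} := by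
        ext p; simp [hwd]
      rw [this]
      exact connected_induce_singleton _
    · have : ({p | p = (v, w) ∨ w ≠ d ∧ p = (u, σ w)} : Set (V × W)) = {(v, w), (u, σ w)} := by
        ext p; simp [hwd]
      rw [this]
      exact induce_pair_connected_of_adj (Or.inl huv.symm)
  · rintro s (rfl | rfl | rfl)
    · exact ⟨(v, w), Or.inl rfl, Or.inl huv⟩
    · exact ⟨(v, w), Or.inl rfl, Or.inl huv⟩
    · by_cases hwd : w = d
      · exact ⟨(v, w), Or.inl rfl, Or.inr ⟨rfl, hwd ▸ hcd⟩⟩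
      · exact ⟨(u, σ w), Or.inr ⟨hwd, rfl⟩, Or.inl huv.symm⟩

lemma card_le_localConn_lexProduct_of_fst_eq [Finite V] [Fintype W] (hT : T.Connected)
    (hH : H.Connected) {x y z : V × W} (hne : x ≠ y) (hxy : x.1 = y.1) (hxz : x.1 ≠ z.1) :
    (Fintype.card W : ℕ∞) ≤ localConn (lexProduct T H) {x, y, z} := by
  obtain ⟨u, a⟩ := x
  obtain ⟨u', b⟩ := y
  obtain ⟨v, c⟩ := z
  obtain rfl : u = u' := hxy
  dsimp only at hxz
  by_cases huv : T.Adj u v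
  · exact card_le_localConn_lexProduct_of_fst_eq_of_adj hH (by simpa using hne) huv
  obtain ⟨I, hI, hdom, hor⟩ := exists_connected_dominating hT {u, v}
  have hu := hdom u (by simp)
  have hv := hdom v (by simp)
  -- A singleton `I` equal to `{u}` or `{v}` would make `u` and `v` adjacent; otherwise `I` misses
  -- two elements of `{u, v}`.
  have hI' : u ∉ I ∧ v ∉ I := by
    rcases hor with hsub | ⟨p, ⟨hp, hpI⟩, q, ⟨hq, hqI⟩, hpq⟩
    · refine ⟨fun huI => ?_, fun hvI => ?_⟩
      · rcases hv with hv | ⟨q, hq, h⟩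
        · exact hxz (hsub huI hv)
        · exact huv (hsub hq huI ▸ h).symm
      · rcases hu with hu | ⟨q, hq, h⟩
        · exact hxz (hsub hu hvI)
        · exact huv (hsub hq hvI ▸ h)
    · rcases hp with rfl | rfl <;> rcases hq with rfl | rfl
      exacts [absurd rfl hpq, ⟨hpI, hqI⟩, ⟨hqI, hpI⟩, absurd rfl hpq]
  refine card_le_localConn_lexProduct_of_adj (nontrivial_triple _ hne) hI ?_ none ?_
  · rintro s (rfl | rfl | rfl)
    exacts [hu.resolve_left hI'.1, hu.resolve_left hI'.1, hv.resolve_left hI'.2]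
  · rintro s (rfl | rfl | rfl) h
    exacts [absurd h hI'.1, absurd h hI'.1, absurd h hI'.2]

/-- If `I = {y.1}`, the three fibres form a path centred at `y.1`. Otherwise `y.1` has a neighbour
in `I`, so `y` sees every copy of `I`, and only the copy at `y.2` meets `S`. -/
lemma card_le_localConn_lexProduct_of_fst_mem [Fintype W] {x y z : V × W} {I : Set V}
    (hxy : x.1 ≠ y.1) (hxz : x.1 ≠ z.1) (hyz : y.1 ≠ z.1) (hI : (T.induce I).Connected)
    (hdom : ∀ u ∈ ({x.1, y.1, z.1} : Set V), u ∈ I ∨ ∃ q ∈ I, T.Adj u q)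
    (hor : I.Subsingleton ∨ (({x.1, y.1, z.1} : Set V) \ I).Nontrivial) (hy : y.1 ∈ I) :
    (Fintype.card W : ℕ∞) ≤ localConn (lexProduct T H) {x, y, z} := by
  have hx := hdom x.1 (by simp)
  have hz := hdom z.1 (by simp)
  by_cases hsub : I.Subsingleton
  · have key : ∀ u, u ≠ y.1 → (u ∈ I ∨ ∃ q ∈ I, T.Adj u q) → T.Adj u y.1 := by
      rintro u hu (h | ⟨q, hq, h⟩)
      · exact absurd (hsub h hy) hu
      · exact hsub hq hy ▸ h
    exact card_le_localConn_lexProduct_of_adj_adj (key _ hxy hx) (key _ hyz.symm hz).symm hxz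
  · have hI' : x.1 ∉ I ∧ z.1 ∉ I := by
      obtain ⟨p, ⟨hp, hpI⟩, q, ⟨hq, hqI⟩, hpq⟩ := hor.resolve_left hsub
      simp only [Set.mem_insert_iff, Set.mem_singleton_iff] at hp hq
      grind
    have hy' := exists_adj_mem_of_connected_induce hI (Set.not_subsingleton_iff.1 hsub) hy
    refine card_le_localConn_lexProduct_of_adj
      (nontrivial_triple _ fun h => hxy (congrArg Prod.fst h)) hI ?_ (some y.2) ?_
    · rintro s (rfl | rfl | rfl)
      exacts [hx.resolve_left hI'.1, hy', hz.resolve_left hI'.2]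
    · rintro s (rfl | rfl | rfl) h
      exacts [absurd h hI'.1, rfl, absurd h hI'.2]

lemma card_le_localConn_lexProduct_of_fst_ne [Finite V] [Fintype W] (hT : T.Connected)
    {x y z : V × W} (hxy : x.1 ≠ y.1) (hxz : x.1 ≠ z.1) (hyz : y.1 ≠ z.1) :
    (Fintype.card W : ℕ∞) ≤ localConn (lexProduct T H) {x, y, z} := by
  obtain ⟨I, hI, hdom, hor⟩ := exists_connected_dominating hT {x.1, y.1, z.1}
  by_cases hy : y.1 ∈ I
  · exact card_le_localConn_lexProduct_of_fst_mem hxy hxz hyz hI hdom hor hy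
  by_cases hx : x.1 ∈ I
  · rw [Set.insert_comm] at hdom hor ⊢
    exact card_le_localConn_lexProduct_of_fst_mem hxy.symm hyz hxz hI hdom hor hx
  by_cases hz : z.1 ∈ I
  · rw [Set.pair_comm] at hdom hor ⊢
    exact card_le_localConn_lexProduct_of_fst_mem hxz hxy hyz.symm hI hdom hor hz
  refine card_le_localConn_lexProduct_of_adj
    (nontrivial_triple _ fun h => hxy (congrArg Prod.fst h)) hI ?_ none ?_
  · rintro s (rfl | rfl | rfl)
    exacts [(hdom _ (by simp)).resolve_left hx, (hdom _ (by simp)).resolve_left hy,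
      (hdom _ (by simp)).resolve_left hz]
  · rintro s (rfl | rfl | rfl) h
    exacts [absurd h hx, absurd h hy, absurd h hz]

lemma card_le_localConn_lexProduct [Finite V] [Fintype W] [Nontrivial V] (hT : T.Connected)
    (hH : H.Connected) {S : Set (V × W)} (hS : S.encard = 3) :
    (Fintype.card W : ℕ∞) ≤ localConn (lexProduct T H) S := by
  obtain ⟨x, y, z, hxy, hxz, hyz, rfl⟩ := Set.encard_eq_three.1 hS
  by_cases h1 : x.1 = y.1
  · by_cases h2 : x.1 = z.1
    · obtain ⟨q, hq⟩ := hT.preconnected.exists_adj_of_nontrivial x.1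
      refine card_le_localConn_lexProduct_of_adj (nontrivial_triple _ hxy)
        (connected_induce_singleton q) ?_ none ?_
      · rintro s (rfl | rfl | rfl)
        exacts [⟨q, rfl, hq⟩, ⟨q, rfl, h1 ▸ hq⟩, ⟨q, rfl, h2 ▸ hq⟩]
      · rintro s (rfl | rfl | rfl) h
        exacts [absurd h hq.ne, absurd h (h1 ▸ hq.ne), absurd h (h2 ▸ hq.ne)]
    · exact card_le_localConn_lexProduct_of_fst_eq hT hH hxy h1 h2
  · by_cases h2 : x.1 = z.1
    · rw [Set.pair_comm]
      exact card_le_localConn_lexProduct_of_fst_eq hT hH hxz h2 h1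
    · by_cases h3 : y.1 = z.1
      · rw [Set.insert_comm, Set.pair_comm]
        exact card_le_localConn_lexProduct_of_fst_eq hT hH hyz h3 (Ne.symm h1)
      · exact card_le_localConn_lexProduct_of_fst_ne hT h1 h2 h3

theorem card_le_genConn_three_lexProduct [Fintype V] [Fintype W] [Nontrivial V]
    (hT : T.Connected) (hH : H.Connected) :
    (Fintype.card W : ℕ∞) ≤ genConn 3 (lexProduct T H) := by
  classical
  have := hH.nonempty
  rw [genConn, if_neg (not_not_intro (connected_lexProduct hT))]
  split_ifs with h
  · rw [ENat.card_eq_coe_fintype_card, Fintype.card_prod] at h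
    have h' : Fintype.card V * Fintype.card W < 3 := by exact_mod_cast h
    have hV : 1 < Fintype.card V := Fintype.one_lt_card
    -- With fewer than three vertices the convention gives the value 1, which is enough.
    have : Fintype.card W ≤ 1 := by nlinarith
    exact_mod_cast this
  · exact le_iInf₂ fun S hS => card_le_localConn_lexProduct hT hH (by simpa using hS)

/-! ### Upper bound for stars -/

/-- If `S` meets two leaf fibres of a star and avoids the fibre over the centre, then every
`S`-tree contains a vertex of the latter, which bounds the number of `S`-trees. -/
lemma localConn_lexProduct_starGraph_le [Fintype W] {c : V} {S : Set (V × W)}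
    (hc : ∀ s ∈ S, s.1 ≠ c) {x y : V × W} (hx : x ∈ S) (hy : y ∈ S) (hxy : x.1 ≠ y.1) :
    localConn (lexProduct (starGraph c) H) S ≤ Fintype.card W := by
  refine iSup₂_le fun F hF => ?_
  have key : ∀ K ∈ F, ∃ w, (c, w) ∈ K.verts := by
    intro K hK
    obtain ⟨htree, hsub⟩ := hF.1 K hK
    by_contra! hcon
    -- Every edge of a star meets the centre, so a tree avoiding the central fibre stays in one
    -- fibre.
    have hstep : ∀ p q : K.verts, K.coe.Adj p q → p.1.1 = q.1.1 := by
      intro p q hpq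
      rcases K.adj_sub hpq with h | ⟨h, -⟩
      · rw [starGraph_adj] at h
        have hne : ∀ r : K.verts, r.1.1 ≠ c := fun r hr => by
          have hr' : r.1 = (c, r.1.2) := Prod.ext hr rfl
          exact hcon r.1.2 (Set.mem_of_eq_of_mem hr'.symm r.2)
        exact absurd h.2 (not_or_intro (hne p) (hne q))
      · exact h
    obtain ⟨p⟩ := htree.connected.preconnected ⟨x, hsub hx⟩ ⟨y, hsub hy⟩
    have hwalk : ∀ {p q : K.verts}, K.coe.Walk p q → p.1.1 = q.1.1 := by
      intro p q r
      induction r with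
      | nil => rfl
      | cons h _ ih => exact (hstep _ _ h).trans ih
    exact hxy (hwalk p)
  have : Nonempty W := ⟨x.2⟩
  choose! f hf using key
  have hinj : Set.InjOn f F := by
    intro K hK K' hK' h
    by_contra hne
    have hmem : (c, f K) ∈ K.verts ∩ K'.verts := ⟨hf K hK, h ▸ hf K' hK'⟩
    rw [(hF.2 hK hK' hne).2] at hmem
    exact hc _ hmem rfl
  rw [← hinj.encard_image, ← ENat.card_eq_coe_fintype_card, ← Set.encard_univ]
  exact Set.encard_le_encard (Set.subset_univ _)

lemma genConn_three_lexProduct_starGraph [Fintype V] [Fintype W] (hV : 4 ≤ Fintype.card V)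
    (c : V) (hH : H.Connected) :
    genConn 3 (lexProduct (starGraph c) H) = Fintype.card W := by
  classical
  have : Nontrivial V := Fintype.one_lt_card_iff_nontrivial.1 (by omega)
  obtain ⟨w⟩ := hH.nonempty
  refine le_antisymm ?_ (card_le_genConn_three_lexProduct (connected_starGraph c) hH)
  have hcard_erase : 3 ≤ (Finset.univ.erase c).card := by
    rw [Finset.card_erase_of_mem (Finset.mem_univ c), Finset.card_univ]
    omega
  obtain ⟨t, ht, htc⟩ := Finset.exists_subset_card_eq hcard_erase
  obtain ⟨x, y, z, hxy, hxz, hyz, rfl⟩ := Finset.card_eq_three.1 htc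
  have hne : ∀ v ∈ ({x, y, z} : Finset V), v ≠ c := fun v hv => Finset.ne_of_mem_erase (ht hv)
  have hS : ({(x, w), (y, w), (z, w)} : Set (V × W)).encard = 3 :=
    Set.encard_eq_three.2 ⟨_, _, _, by simpa using hxy, by simpa using hxz, by simpa using hyz, rfl⟩
  have hcard : ¬ ENat.card (V × W) < (3 : ℕ) := by
    rw [not_lt, Nat.cast_ofNat, ← hS, ← Set.encard_univ]
    exact Set.encard_le_encard (Set.subset_univ _)
  have : Nonempty W := ⟨w⟩
  rw [genConn, if_neg (not_not_intro (connected_lexProduct (connected_starGraph c))),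
    if_neg hcard]
  refine (iInf₂_le _ (by simpa using hS)).trans (localConn_lexProduct_starGraph_le (c := c)
    (x := (x, w)) (y := (y, w)) ?_ (by simp) (by simp) hxy)
  rintro s (rfl | rfl | rfl)
  exacts [hne x (by simp), hne y (by simp), hne z (by simp)]

end LexProduct

end GenConn

theorem proposition2p7 :
    (∀ (V W : Type*) [Fintype V] [Fintype W] [Nontrivial V]
      (T : SimpleGraph V) (H : SimpleGraph W), T.IsTree → H.Connected →
        (Fintype.card W : ℕ∞) ≤ GenConn.genConn 3 (GenConn.lexProduct T H)) ∧
    (∀ (n : ℕ) (c : Fin n), 4 ≤ n →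
      GenConn.genConn 3
        (GenConn.lexProduct (SimpleGraph.starGraph c) (SimpleGraph.pathGraph 3)) = 3) := by
  refine ⟨fun V W _ _ _ T H hT hH =>
    GenConn.card_le_genConn_three_lexProduct hT.connected hH, fun n c hn => ?_⟩
  rw [GenConn.genConn_three_lexProduct_starGraph (by simpa using hn) c
    (SimpleGraph.pathGraph_connected 2)]
  simp
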